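/- Let $\mathbb{T}=(\mathbb{R}\cup\{-\infty\},\oplus,\odot)$ and $\overline{\mathbb{Z}}=(\mathbb{Z}\cup\{-\infty\},\oplus,\odot)$ be the max-plus tropical semirings, where $a\oplus b=\max\{a,b\}$ and $a\odot b=a+b$. Let $U_2(\mathbb{T})$ and $U_2(\overline{\mathbb{Z}})$ be the monoids, under tropical matrix multiplication, of all upper triangular $2\times 2$ matrices over $\mathbb{T}$ and $\overline{\mathbb{Z}}$ respectively (upper triangular means that the lower left entry is $-\infty$). An identity is a formal expression $\mathbf{u}\approx\mathbf{v}$ where $\mathbf{u},\mathbf{v}$ are elements of the free semigroup $\mathcal{X}^+$ of nonempty words over a countably infinite alphabet $\mathcal{X}$. A semigroup $S$ satisfies $\mathbf{u}\approx\mathbf{v}$ if $\varphi(\mathbf{u})=\varphi(\mathbf{v})$ for every homomorphism $\varphi:\mathcal{X}^+\to S$. An identity basis for $S$ is a set $\Sigma$ of identities satisfied by $S$ from which every identity satisfied by $S$ can be derived, that is, such that the fully invariant congruence on $\mathcal{X}^+$ generated by $\Sigma$ consists exactly of the identities satisfied by $S$. The axiomatic rank of $S$ is the least natural number $k$ such that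 $S$ has an identity basis each of whose identities involves at most $k$ variables (letters occurring in at least one of its two sides); it is infinite if no such $k$ exists. Then $U_2(\mathbb{T})$ and $U_2(\overline{\mathbb{Z}})$ are both of infinite axiomatic rank. -/

import Mathlib

/-- The max-plus tropical semiring over `R`: the set `R ∪ {-∞}` with `a ⊕ b = max a b` and
`a ⊙ b = a + b`. Mathlib's `Tropical` uses the minimum, so the order of `R` is reversed; the top
element of `WithTop Rᵒᵈ` is `-∞`, which is the zero of the semiring. -/
abbrev MaxPlus (R : Type*) : Type _ := Tropical (WithTop Rᵒᵈ)

/-- The multiplicative monoid `U_n(S)` of upper triangular `n × n` matrices over a semiring `S`. -/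
abbrev UpperTriangularMonoid (n : ℕ) (S : Type*) [Semiring S] : Submonoid (Matrix (Fin n) (Fin n) S) :=
  (Matrix.blockTriangularSubsemiring S (id : Fin n → Fin n)).toSubmonoid

namespace SemigroupIdentity

/-- Nonempty words over the countably infinite alphabet `ℕ`. -/
abbrev Word : Type := FreeSemigroup ℕ

/-- The content of a word: the finite set of letters occurring in it. -/
def content (w : Word) : Finset ℕ := insert w.head w.tail.toFinset

/-- The pair `(u, v)` represents the identity `u ≈ v`; this is the set of variables in it. -/
def vars (e : Word × Word) : Finset ℕ := content e.1 ∪ content e.2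

/-- `Id(S)`: the set of all identities satisfied by the semigroup `S`, that is, of all pairs of
words that have equal values under every assignment. -/
def identities (S : Type*) [Semigroup S] : Set (Word × Word) :=
  {e | ∀ φ : Word →ₙ* S, φ e.1 = φ e.2}

/-- `Id(Γ)`: the set of all identities that can be derived from `Γ`, that is, the fully invariant
congruence generated by `Γ`. -/
def consequences (Γ : Set (Word × Word)) : Set (Word × Word) :=
  {e | conGen (fun a b : Word => ∃ p ∈ Γ, ∃ θ : Word →ₙ* Word, a = θ p.1 ∧ b = θ p.2) e.1 e.2}

/-- `Γ` is an identity basis for `S`. -/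
def IsIdentityBasis (Γ : Set (Word × Word)) (S : Type*) [Semigroup S] : Prop :=
  Γ ⊆ identities S ∧ consequences Γ = identities S

/-- The axiomatic rank of `S`: the least `k` such that `S` has an identity basis each of whose
identities involves at most `k` variables, and `⊤` (infinity) if there is no such `k`. -/
noncomputable def axiomaticRank (S : Type*) [Semigroup S] : ℕ∞ :=
  ⨅ (k : ℕ) (_ : ∃ Γ, IsIdentityBasis Γ S ∧ ∀ e ∈ Γ, (vars e).card ≤ k), (k : ℕ∞)

end SemigroupIdentity

/-! Two facts about `U_2` carry the proof. First, under a suitable substitution the upper right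
entry of a word's value is the maximum of a linear functional over the prefix vectors of a letter,
so identities preserve all such maxima (`sameMaxima_of_prod_eq`). Second, `P Q P P Q ≈ P Q Q P Q`
holds for every length `n` of `P`: the values of `P` and `Q` have the same diagonal, and the one
term in which the two sides differ is absorbed by `a² c ≤ a³ ⊕ c³` (`adjan_identity_matrix`).

These identities are rigid: the maxima leave only the two words themselves
(`SameMaxima.eq_adjanLeft_or_eq_adjanRight`). For each letter, four of the five prefix vectors are
forced, and the middle one lies in the convex hull of the others with two possible values;
comparability of prefixes forces the same choice at all letters.

Any derivation must therefore jump from one word to the other in a single step, replacing `θ p` by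
`θ q` for a basis identity. Here `p` and `q` are balanced and, with at most `k` variables, `p` has
length at most `5k`. Such a step only rearranges blocks, so the ascents lost number at most the `5k
+ 2` seams, while the two words differ by about `n` ascents (`append_flatMap_ne_adjanRight`). -/

namespace SemigroupIdentity

/-! ### Prefix vectors -/

/-- The Parikh vectors of the prefixes of `l` that end just before an occurrence of `i`. -/
def prefixVectors (i : ℕ) : List ℕ → List (ℕ → ℤ)
  | [] => []
  | h :: t => (if h = i then [0] else []) ++ (prefixVectors i t).map (Pi.single h 1 + ·)

/-- The Parikh vector of a list of letters. -/
def parikh (l : List ℕ) : ℕ → ℤ := fun j => l.count j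

theorem prefixVectors_append (i : ℕ) (l₁ l₂ : List ℕ) :
    prefixVectors i (l₁ ++ l₂) =
      prefixVectors i l₁ ++ (prefixVectors i l₂).map (parikh l₁ + ·) := by
  induction l₁ with
  | nil =>
    have : parikh [] = 0 := by ext; simp [parikh]
    simp [prefixVectors, this]
  | cons h t ih =>
    have : parikh (h :: t) = Pi.single h 1 + parikh t := by
      ext j
      by_cases hj : j = h
      · subst hj; simp [parikh, add_comm]
      · simp [parikh, List.count_cons_of_ne (Ne.symm hj), hj]
    simp [prefixVectors, ih, this, Function.comp_def, add_assoc]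

theorem nonneg_of_mem_prefixVectors {i : ℕ} {l : List ℕ} {v : ℕ → ℤ}
    (hv : v ∈ prefixVectors i l) : 0 ≤ v := by
  induction l generalizing v with
  | nil => simp [prefixVectors] at hv
  | cons h t ih =>
    simp only [prefixVectors, List.mem_append, List.mem_map] at hv
    rcases hv with hv | ⟨v', hv', rfl⟩
    · split_ifs at hv <;> simp_all
    · exact add_nonneg (Pi.single_nonneg.2 zero_le_one) (ih hv')

theorem pairwise_prefixVectors (i : ℕ) (l : List ℕ) :
    (prefixVectors i l).Pairwise (· ≤ ·) := by
  induction l with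
  | nil => simp [prefixVectors]
  | cons h t ih =>
    rw [prefixVectors, List.pairwise_append]
    refine ⟨by split_ifs <;> simp, ?_, ?_⟩
    · exact ih.map _ fun a b hab => add_le_add_right hab _
    · intro a ha b hb
      have hb' : b ∈ prefixVectors i (h :: t) := by
        rw [prefixVectors]; exact List.mem_append_right _ hb
      split_ifs at ha
      · simp only [List.mem_singleton] at ha
        subst ha
        exact nonneg_of_mem_prefixVectors hb'
      · simp at ha

/-- Coordinate `i` numbers the occurrences of `i`, so it identifies a prefix vector within its list.
-/
theorem map_self_prefixVectors (i : ℕ) (l : List ℕ) :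
    (prefixVectors i l).map (· i) = (List.range (l.count i)).map (fun k : ℕ => (k : ℤ)) := by
  induction l with
  | nil => simp [prefixVectors]
  | cons h t ih =>
    by_cases hi : h = i
    · subst hi
      have := congrArg (List.map (fun z : ℤ => 1 + z)) ih
      simp only [List.map_map] at this
      simp [prefixVectors, List.range_succ_eq_map, Function.comp_def] at this ⊢
      rw [this]
      simp [add_comm]
    · have h' : (Pi.single h (1 : ℤ) : ℕ → ℤ) i = 0 := Pi.single_eq_of_ne (Ne.symm hi) _
      simpa [prefixVectors, hi, Function.comp_def, h', List.count_cons_of_ne hi] using ih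

/-- Prefixes ending before occurrences of distinct letters are comparable. -/
theorem prefixVectors_comparable {i j : ℕ} (hij : i ≠ j) {l : List ℕ} {v w : ℕ → ℤ}
    (hv : v ∈ prefixVectors i l) (hw : w ∈ prefixVectors j l) :
    v + Pi.single i 1 ≤ w ∨ w + Pi.single j 1 ≤ v := by
  induction l generalizing v w with
  | nil => simp [prefixVectors] at hv
  | cons h t ih =>
    simp only [prefixVectors, List.mem_append, List.mem_map] at hv hw
    rcases hv with hv | ⟨v', hv', rfl⟩ <;> rcases hw with hw | ⟨w', hw', rfl⟩
    · split_ifs at hv hw <;> simp_all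
    · split_ifs at hv with hi
      · simp only [List.mem_singleton] at hv
        subst hv hi
        left
        rw [zero_add]
        exact le_add_of_nonneg_right (nonneg_of_mem_prefixVectors hw')
      · simp at hv
    · split_ifs at hw with hi
      · simp only [List.mem_singleton] at hw
        subst hw hi
        right
        rw [zero_add]
        exact le_add_of_nonneg_right (nonneg_of_mem_prefixVectors hv')
      · simp at hw
    · rcases ih hv' hw' with hh | hh
      · left; rw [add_assoc]; exact add_le_add_right hh _
      · right; rw [add_assoc]; exact add_le_add_right hh _

/-- The vector `0` is listed for the first letter only, so that letter can be read off and removed.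
-/
theorem eq_of_prefixVectors_eq {l l' : List ℕ}
    (h : ∀ i, prefixVectors i l = prefixVectors i l') : l = l' := by
  induction l generalizing l' with
  | nil =>
    cases l' with
    | nil => rfl
    | cons b t' => simpa [prefixVectors] using h b
  | cons a t ih =>
    cases l' with
    | nil => simpa [prefixVectors] using h a
    | cons b t' =>
      have hab : a = b := by
        by_contra hab
        have h1 := h b
        have h0 : (0 : ℕ → ℤ) ∈ prefixVectors b (a :: t) := by
          rw [h1]; simp [prefixVectors]
        simp only [prefixVectors, if_neg hab, List.nil_append, List.mem_map] at h0
        obtain ⟨v, hv, hv0⟩ := h0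
        have h2 := congrFun hv0 a
        have h3 := nonneg_of_mem_prefixVectors hv a
        simp at h2 h3
        omega
      subst hab
      congr 1
      refine ih fun i => ?_
      have := h i
      rw [prefixVectors, prefixVectors] at this
      exact List.map_injective_iff.2 (add_right_injective _) (List.append_cancel_left this)

/-! ### The words of the Adjan type identities -/

/-- The word `P Q P P Q`, where `P = x₀ ⋯ xₙ₋₁` and `Q` is the reverse of `P`. -/
def adjanLeft (n : ℕ) : List ℕ :=
  List.range n ++ (List.range n).reverse ++ List.range n ++ List.range n ++ (List.range n).reverse

/-- The word `P Q Q P Q`, where `P = x₀ ⋯ xₙ₋₁` and `Q` is the reverse of `P`. -/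
def adjanRight (n : ℕ) : List ℕ :=
  List.range n ++ (List.range n).reverse ++ (List.range n).reverse ++ List.range n ++
    (List.range n).reverse

/-- The vector with value `a` at the letters below `i`, `b` at `i`, `c` at the letters between `i`
and `n`, and `0` from `n` on. -/
def stepVector (n i : ℕ) (a b c : ℤ) : ℕ → ℤ :=
  fun j => if n ≤ j then 0 else if j < i then a else if j = i then b else c

theorem count_range (n j : ℕ) : (List.range n).count j = if n ≤ j then 0 else 1 := by
  split_ifs with h
  · exact List.count_eq_zero.2 (by simpa using h)
  · exact List.count_eq_one_of_mem List.nodup_range (by simpa using h)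

theorem parikh_range (n i : ℕ) : parikh (List.range n) = stepVector n i 1 1 1 := by
  ext j
  simp only [parikh, stepVector, count_range]
  split_ifs <;> simp

theorem prefixVectors_range (n i : ℕ) :
    prefixVectors i (List.range n) = if i < n then [stepVector n i 1 0 0] else [] := by
  induction n with
  | zero => simp [prefixVectors]
  | succ n ih =>
    rw [List.range_succ, prefixVectors_append, ih, parikh_range n i]
    rcases lt_trichotomy i n with h | h | h
    · rw [if_pos h, if_pos (by omega)]
      simp only [prefixVectors, if_neg h.ne']
      simp only [List.map_nil, List.append_nil]
      congr 1
      ext j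
      simp only [stepVector]
      split_ifs <;> first | rfl | omega
    · subst h
      simp only [prefixVectors]
      simp only [lt_irrefl, if_false, if_true, List.map_nil, List.append_nil, List.nil_append,
        List.map_cons, lt_add_one, add_zero]
      congr 1
      ext j
      simp only [stepVector]
      split_ifs <;> first | rfl | omega
    · rw [if_neg (by omega), if_neg (by omega)]
      simp [prefixVectors, h.ne]

theorem prefixVectors_reverse_range (n i : ℕ) :
    prefixVectors i (List.range n).reverse = if i < n then [stepVector n i 0 0 1] else [] := by
  induction n with
  | zero => simp [prefixVectors]
  | succ n ih =>
    rw [List.range_succ, List.reverse_append, List.reverse_singleton, List.singleton_append,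
      prefixVectors, ih]
    rcases lt_trichotomy i n with h | h | h
    · rw [if_neg h.ne', if_pos h, if_pos (by omega)]
      simp only [List.nil_append, List.map_cons, List.map_nil]
      congr 1
      ext j
      simp only [stepVector, Pi.add_apply, Pi.single_apply]
      split_ifs <;> first | rfl | omega
    · subst h
      simp only [lt_irrefl, if_false, if_true, List.map_nil, List.append_nil, lt_add_one]
      congr 1
      ext j
      simp only [stepVector, Pi.zero_apply]
      split_ifs <;> first | rfl | omega
    · rw [if_neg h.ne, if_neg (by omega), if_neg (by omega)]
      rfl

theorem parikh_reverse (l : List ℕ) : parikh l.reverse = parikh l := by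
  ext j; simp [parikh]

theorem stepVector_add (n i : ℕ) (a b c a' b' c' : ℤ) :
    stepVector n i a b c + stepVector n i a' b' c' =
      stepVector n i (a + a') (b + b') (c + c') := by
  ext j
  simp only [stepVector, Pi.add_apply]
  split_ifs <;> simp

theorem prefixVectors_adjanLeft {n i : ℕ} (h : i < n) :
    prefixVectors i (adjanLeft n) = [stepVector n i 1 0 0, stepVector n i 1 1 2,
      stepVector n i 3 2 2, stepVector n i 4 3 3, stepVector n i 4 4 5] := by
  simp [adjanLeft, prefixVectors_append, prefixVectors_range, prefixVectors_reverse_range, h,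
    parikh_reverse, parikh_range n i, stepVector_add]

theorem prefixVectors_adjanRight {n i : ℕ} (h : i < n) :
    prefixVectors i (adjanRight n) = [stepVector n i 1 0 0, stepVector n i 1 1 2,
      stepVector n i 2 2 3, stepVector n i 4 3 3, stepVector n i 4 4 5] := by
  simp [adjanRight, prefixVectors_append, prefixVectors_range, prefixVectors_reverse_range, h,
    parikh_reverse, parikh_range n i, stepVector_add]

theorem prefixVectors_adjanLeft_of_le {n i : ℕ} (h : n ≤ i) :
    prefixVectors i (adjanLeft n) = [] := by
  simp [adjanLeft, prefixVectors_append, prefixVectors_range, prefixVectors_reverse_range, h]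

theorem prefixVectors_adjanRight_of_le {n i : ℕ} (h : n ≤ i) :
    prefixVectors i (adjanRight n) = [] := by
  simp [adjanRight, prefixVectors_append, prefixVectors_range, prefixVectors_reverse_range, h]

/-! ### Rigidity of `P Q P P Q` under linear constraints -/

/-- On the prefix vectors of `l` and `l'` every linear functional has the same upper bounds. -/
def SameMaxima (l l' : List ℕ) : Prop :=
  ∀ (i : ℕ) (L : (ℕ → ℤ) →+ ℤ) (m : ℤ),
    (∀ v ∈ prefixVectors i l, L v ≤ m) ↔ ∀ v ∈ prefixVectors i l', L v ≤ m

theorem count_le_iff (i : ℕ) (l : List ℕ) (c : ℕ) :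
    l.count i ≤ c ↔ ∀ v ∈ prefixVectors i l, v i ≤ (c : ℤ) - 1 := by
  have h : (∀ v ∈ prefixVectors i l, v i ≤ (c : ℤ) - 1) ↔
      ∀ z ∈ (prefixVectors i l).map (· i), z ≤ (c : ℤ) - 1 := by simp
  rw [h, map_self_prefixVectors]
  simp only [List.mem_map, List.mem_range, forall_exists_index, and_imp, forall_apply_eq_imp_iff₂]
  constructor
  · intro h k hk
    omega
  · intro h
    by_contra! hc
    have := h c hc
    omega

theorem SameMaxima.count_eq {l l' : List ℕ} (h : SameMaxima l l') (i : ℕ) :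
    l.count i = l'.count i := by
  have key (c : ℕ) : l.count i ≤ c ↔ l'.count i ≤ c := by
    rw [count_le_iff, count_le_iff]
    exact h i (Pi.evalAddMonoidHom _ i) _
  exact le_antisymm ((key _).2 le_rfl) ((key _).1 le_rfl)

theorem SameMaxima.exists_eq {l l' : List ℕ} (h : SameMaxima l l') {i : ℕ}
    (L : (ℕ → ℤ) →+ ℤ) (m : ℤ) (hmax : ∀ v ∈ prefixVectors i l', L v ≤ m)
    (hm : ∃ v ∈ prefixVectors i l', L v = m) :
    (∀ v ∈ prefixVectors i l, L v ≤ m) ∧ ∃ v ∈ prefixVectors i l, L v = m := by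
  have h1 := (h i L m).2 hmax
  refine ⟨h1, ?_⟩
  by_contra! hc
  obtain ⟨v, hv, hvm⟩ := hm
  -- Integrality: an unattained bound `m` improves to `m - 1`, which transfers to `l'`.
  have := (h i L (m - 1)).1 (fun w hw => by
    have := h1 w hw
    have := hc w hw
    omega) v hv
  omega

/-- The functional `v ↦ a * v i + b * v j + c * v k`. -/
def threeCoord (i j k : ℕ) (a b c : ℤ) : (ℕ → ℤ) →+ ℤ :=
  a • Pi.evalAddMonoidHom (fun _ : ℕ => ℤ) i + b • Pi.evalAddMonoidHom (fun _ : ℕ => ℤ) j +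
    c • Pi.evalAddMonoidHom (fun _ : ℕ => ℤ) k

theorem threeCoord_apply (i j k : ℕ) (a b c : ℤ) (v : ℕ → ℤ) :
    threeCoord i j k a b c v = a * v i + b * v j + c * v k := by
  simp [threeCoord]

theorem count_adjanLeft (n i : ℕ) : (adjanLeft n).count i = if n ≤ i then 0 else 5 := by
  simp only [adjanLeft, List.count_append, List.count_reverse, count_range]
  split_ifs <;> rfl

theorem SameMaxima.exists_five {n : ℕ} {w : List ℕ} (h : SameMaxima w (adjanLeft n)) {i : ℕ}
    (hi : i < n) : ∃ v₀ v₁ v₂ v₃ v₄ : ℕ → ℤ, prefixVectors i w = [v₀, v₁, v₂, v₃, v₄] ∧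
      (v₀ i = 0 ∧ v₁ i = 1 ∧ v₂ i = 2 ∧ v₃ i = 3 ∧ v₄ i = 4) ∧
      (0 ≤ v₀ ∧ v₀ ≤ v₁ ∧ v₁ ≤ v₂ ∧ v₂ ≤ v₃ ∧ v₃ ≤ v₄) := by
  have h1 := map_self_prefixVectors i w
  rw [h.count_eq, count_adjanLeft, if_neg (by omega)] at h1
  have h2 := pairwise_prefixVectors i w
  have h3 : ∀ v ∈ prefixVectors i w, 0 ≤ v := fun v => nonneg_of_mem_prefixVectors
  generalize prefixVectors i w = V at h1 h2 h3 ⊢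
  rcases V with _ | ⟨v₀, _ | ⟨v₁, _ | ⟨v₂, _ | ⟨v₃, _ | ⟨v₄, _ | ⟨v₅, t⟩⟩⟩⟩⟩⟩ <;>
    simp [List.range_succ] at h1
  refine ⟨v₀, v₁, v₂, v₃, v₄, rfl, h1, ?_⟩
  simp only [List.pairwise_cons, List.mem_cons, forall_eq_or_imp, List.not_mem_nil] at h2 h3
  exact ⟨h3.1, h2.1.1, h2.2.1.1, h2.2.2.1.1, h2.2.2.2.1.1⟩

/-- A word satisfying the same linear constraints as `P Q P P Q` has the same prefix vectors as
`P Q P P Q` or `P Q Q P Q`, letter by letter. -/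
theorem SameMaxima.prefixVectors_eq {n : ℕ} {w : List ℕ} (h : SameMaxima w (adjanLeft n)) {i : ℕ}
    (hi : i < n) : prefixVectors i w = prefixVectors i (adjanLeft n) ∨
      prefixVectors i w = prefixVectors i (adjanRight n) := by
  obtain ⟨v₀, v₁, v₂, v₃, v₄, hw, ⟨e₀, e₁, e₂, e₃, e₄⟩, m₀, m₁, m₂, m₃, m₄⟩ := h.exists_five hi
  have test (j k : ℕ) (a b c m : ℤ) := h.exists_eq (i := i) (threeCoord i j k a b c) m
  simp only [hw, prefixVectors_adjanLeft hi, threeCoord_apply, List.mem_cons, List.not_mem_nil,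
    or_false, forall_eq_or_imp, forall_eq, exists_eq_or_imp, exists_eq_left] at test
  have outside {j : ℕ} (hj : n ≤ j) :
      v₀ j = 0 ∧ v₁ j = 0 ∧ v₂ j = 0 ∧ v₃ j = 0 ∧ v₄ j = 0 := by
    have t := test j j 0 1 0 (0)
      (by simp [stepVector, hj])
      (by simp [stepVector, hj])
    have := m₀ j
    have := m₁ j
    have := m₂ j
    have := m₃ j
    have := m₄ j
    simp only [Pi.zero_apply] at *
    omega
  have below {j : ℕ} (hj : j < i) : v₀ j = 1 ∧ v₁ j = 1 ∧ (v₂ j = 2 ∨ v₂ j = 3) ∧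
      v₃ j = 4 ∧ v₄ j = 4 := by
    have hn : ¬ n ≤ j := by omega
    have hn' : ¬ n ≤ i := by omega
    -- In the `(i, j)` plane this functional exposes the vertex `(3, 4)`, and the next one `(1, 1)`.
    -- As coordinate `i` runs over `0, …, 4`, equality modulo 5 determines which vector attains the
    -- maximum.
    have t₁ := test j j (-3) 5 0 (11)
      (by simp [stepVector, hj, hn, hn'])
      (by simp [stepVector, hj, hn, hn'])
    have t₂ := test j j 3 (-5) 0 (-2)
      (by simp [stepVector, hj, hn, hn'])
      (by simp [stepVector, hj, hn, hn'])
    have t₃ := test j j 0 1 0 (4)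
      (by simp [stepVector, hj, hn])
      (by simp [stepVector, hj, hn])
    have := m₀ j
    have := m₁ j
    have := m₂ j
    have := m₃ j
    have := m₄ j
    simp only [Pi.zero_apply] at *
    omega
  have above {j : ℕ} (hj : i < j) (hjn : j < n) : v₀ j = 0 ∧ v₁ j = 2 ∧ (v₂ j = 2 ∨ v₂ j = 3) ∧
      v₃ j = 3 ∧ v₄ j = 5 := by
    have hn : ¬ n ≤ j := by omega
    have hn' : ¬ n ≤ i := by omega
    have hj' : ¬ j < i := by omega
    have hj'' : ¬ j = i := by omega
    -- The exposed vertices are now `(1, 2)` and `(3, 3)`; other integer solutions violate `0 ≤ v j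
    -- ≤ 5`.
    have t₁ := test j j (-5) 3 0 (1)
      (by simp [stepVector, hj', hj'', hn, hn'])
      (by simp [stepVector, hj', hj'', hn, hn'])
    have t₂ := test j j 5 (-3) 0 (6)
      (by simp [stepVector, hj', hj'', hn, hn'])
      (by simp [stepVector, hj', hj'', hn, hn'])
    have t₃ := test j j 0 1 0 (5)
      (by simp [stepVector, hj', hj'', hn])
      (by simp [stepVector, hj', hj'', hn])
    have := m₀ j
    have := m₁ j
    have := m₂ j
    have := m₃ j
    have := m₄ j
    simp only [Pi.zero_apply] at *
    omega
  have same_below {j k : ℕ} (hj : j < i) (hk : k < i) : v₂ j = v₂ k := by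
    have hn : ¬ n ≤ j := by omega
    have hn' : ¬ n ≤ k := by omega
    have t₁ := test j k 0 1 (-1) (0)
      (by simp [stepVector, hj, hk, hn, hn'])
      (by simp [stepVector, hj, hk, hn, hn'])
    have t₂ := test j k 0 (-1) 1 (0)
      (by simp [stepVector, hj, hk, hn, hn'])
      (by simp [stepVector, hj, hk, hn, hn'])
    omega
  have same_above {j k : ℕ} (hj : i < j) (hk : i < k) (hjn : j < n) (hkn : k < n) :
      v₂ j = v₂ k := by
    have hn : ¬ n ≤ j := by omega
    have hn' : ¬ n ≤ k := by omega
    have hj' : ¬ j < i := by omega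
    have hj'' : ¬ j = i := by omega
    have hk' : ¬ k < i := by omega
    have hk'' : ¬ k = i := by omega
    have t₁ := test j k 0 1 (-1) (0)
      (by simp [stepVector, hj', hj'', hk', hk'', hn, hn'])
      (by simp [stepVector, hj', hj'', hk', hk'', hn, hn'])
    have t₂ := test j k 0 (-1) 1 (0)
      (by simp [stepVector, hj', hj'', hk', hk'', hn, hn'])
      (by simp [stepVector, hj', hj'', hk', hk'', hn, hn'])
    omega
  have across {j k : ℕ} (hj : j < i) (hk : i < k) (hkn : k < n) : v₂ j + v₂ k = 5 := by
    have hn : ¬ n ≤ j := by omega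
    have hn' : ¬ n ≤ k := by omega
    have hn'' : ¬ n ≤ i := by omega
    have hk' : ¬ k < i := by omega
    have hk'' : ¬ k = i := by omega
    -- `v j + v k - 2 * v i` equals 1 on all five vectors of `P Q P P Q`, so bounding it from both
    -- sides gives an equation.
    have t₁ := test j k (-2) 1 1 (1)
      (by simp [stepVector, hj, hk', hk'', hn, hn', hn''])
      (by simp [stepVector, hj, hk', hk'', hn, hn', hn''])
    have t₂ := test j k 2 (-1) (-1) (-1)
      (by simp [stepVector, hj, hk', hk'', hn, hn', hn''])
      (by simp [stepVector, hj, hk', hk'', hn, hn', hn''])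
    omega
  have hmid : v₂ = stepVector n i 3 2 2 ∨ v₂ = stepVector n i 2 2 3 := by
    by_cases hc : (∀ j < i, v₂ j = 3) ∧ ∀ j, i < j → j < n → v₂ j = 2
    · left
      ext j
      simp only [stepVector]
      split_ifs with h1 h2 h3
      · exact (outside h1).2.2.1
      · exact hc.1 j h2
      · rw [h3, e₂]
      · exact hc.2 j (by omega) (by omega)
    · right
      have hb : (∀ j < i, v₂ j = 2) ∧ ∀ j, i < j → j < n → v₂ j = 3 := by
        by_contra hc'
        apply hc
        simp only [not_and_or, not_forall] at hc'
        rcases hc' with ⟨k, hk, hk'⟩ | ⟨k, hk, hkn, hk'⟩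
        · refine ⟨fun j hj => ?_, fun j hj hjn => ?_⟩
          · have := same_below hk hj
            have := (below hk).2.2.1
            omega
          · have := across hk hj hjn
            have := (below hk).2.2.1
            omega
        · refine ⟨fun j hj => ?_, fun j hj hjn => ?_⟩
          · have := across hj hk hkn
            have := (above hk hkn).2.2.1
            omega
          · have := same_above hk hj hkn hjn
            have := (above hk hkn).2.2.1
            omega
      ext j
      simp only [stepVector]
      split_ifs with h1 h2 h3
      · exact (outside h1).2.2.1
      · exact hb.1 j h2
      · rw [h3, e₂]
      · exact hb.2 j (by omega) (by omega)
  have h₀ : v₀ = stepVector n i 1 0 0 := by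
    ext j
    simp only [stepVector]
    split_ifs with h1 h2 h3
    · exact (outside h1).1
    · exact (below h2).1
    · rw [h3, e₀]
    · exact (above (by omega) (by omega)).1
  have h₁ : v₁ = stepVector n i 1 1 2 := by
    ext j
    simp only [stepVector]
    split_ifs with h1 h2 h3
    · exact (outside h1).2.1
    · exact (below h2).2.1
    · rw [h3, e₁]
    · exact (above (by omega) (by omega)).2.1
  have h₃ : v₃ = stepVector n i 4 3 3 := by
    ext j
    simp only [stepVector]
    split_ifs with h1 h2 h3
    · exact (outside h1).2.2.2.1
    · exact (below h2).2.2.2.1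
    · rw [h3, e₃]
    · exact (above (by omega) (by omega)).2.2.2.1
  have h₄ : v₄ = stepVector n i 4 4 5 := by
    ext j
    simp only [stepVector]
    split_ifs with h1 h2 h3
    · exact (outside h1).2.2.2.2
    · exact (below h2).2.2.2.2
    · rw [h3, e₄]
    · exact (above (by omega) (by omega)).2.2.2.2
  rw [hw, prefixVectors_adjanLeft hi, prefixVectors_adjanRight hi, h₀, h₁, h₃, h₄]
  exact hmid.imp (fun e => by rw [e]) (fun e => by rw [e])

theorem not_prefixVectors_mixed {n i j : ℕ} {w : List ℕ} (hij : i < j) (hj : j < n) :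
    ¬ (prefixVectors i w = prefixVectors i (adjanLeft n) ∧
      prefixVectors j w = prefixVectors j (adjanRight n)) ∧
    ¬ (prefixVectors i w = prefixVectors i (adjanRight n) ∧
      prefixVectors j w = prefixVectors j (adjanLeft n)) := by
  have hi : i < n := by omega
  have h1 : ¬ n ≤ i := by omega
  have h2 : ¬ n ≤ j := by omega
  have h3 : ¬ j < i := by omega
  have h4 : ¬ j = i := by omega
  have h5 : ¬ i = j := by omega
  rw [prefixVectors_adjanLeft hi, prefixVectors_adjanRight hj, prefixVectors_adjanLeft hj,
    prefixVectors_adjanRight hi]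
  constructor
  · rintro ⟨hl, hr⟩
    -- The third occurrences clash: both vectors have `(i, j)` coordinates `(2, 2)`, so neither
    -- prefix can contain the other's final letter. In the other case they are `(2, 3)` and `(3,
    -- 2)`.
    rcases prefixVectors_comparable hij.ne (l := w) (v := stepVector n i 3 2 2)
      (w := stepVector n j 2 2 3) (by simp [hl]) (by simp [hr]) with h | h
    · have := h i
      simp [stepVector, h1, hij] at this
    · have := h j
      simp [stepVector, h2, h3, h4] at this
  · rintro ⟨hl, hr⟩
    rcases prefixVectors_comparable hij.ne (l := w) (v := stepVector n i 2 2 3)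
      (w := stepVector n j 3 2 2) (by simp [hl]) (by simp [hr]) with h | h
    · have := h j
      simp [stepVector, h2, h3, h4] at this
    · have := h i
      simp [stepVector, h1, hij, h5] at this

/-- Only `P Q P P Q` and `P Q Q P Q` satisfy the same linear constraints as `P Q P P Q`. -/
theorem SameMaxima.eq_adjanLeft_or_eq_adjanRight {n : ℕ} {w : List ℕ}
    (h : SameMaxima w (adjanLeft n)) : w = adjanLeft n ∨ w = adjanRight n := by
  have hout (i : ℕ) (hi : n ≤ i) : prefixVectors i w = [] := by
    -- The zero functional with bound `-1` expresses that there are no prefix vectors.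
    have := (h i 0 (-1)).2 (by simp [prefixVectors_adjanLeft_of_le hi])
    exact List.eq_nil_iff_forall_not_mem.2 fun v hv => by simpa using this v hv
  rcases Nat.eq_zero_or_pos n with rfl | hn
  · left
    exact eq_of_prefixVectors_eq fun i => by
      rw [hout i (Nat.zero_le _), prefixVectors_adjanLeft_of_le (Nat.zero_le _)]
  refine (h.prefixVectors_eq hn).imp (fun h0 => ?_) (fun h0 => ?_)
  · refine eq_of_prefixVectors_eq fun i => ?_
    rcases lt_or_ge i n with hi | hi
    · rcases Nat.eq_zero_or_pos i with rfl | hpos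
      · exact h0
      · exact (h.prefixVectors_eq hi).resolve_right fun hr =>
          (not_prefixVectors_mixed hpos hi).1 ⟨h0, hr⟩
    · rw [hout i hi, prefixVectors_adjanLeft_of_le hi]
  · refine eq_of_prefixVectors_eq fun i => ?_
    rcases lt_or_ge i n with hi | hi
    · rcases Nat.eq_zero_or_pos i with rfl | hpos
      · exact h0
      · exact (h.prefixVectors_eq hi).resolve_left fun hr =>
          (not_prefixVectors_mixed hpos hi).2 ⟨h0, hr⟩
    · rw [hout i hi, prefixVectors_adjanRight_of_le hi]

/-! ### Counting consecutive pairs of letters -/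

/-- The number of factors of the form `x (x + 1)` in a list. -/
def ascents : List ℕ → ℕ
  | [] => 0
  | x :: l => (if l.head? = some (x + 1) then 1 else 0) + ascents l

theorem ascents_cons_cons (x y : ℕ) (l : List ℕ) :
    ascents (x :: y :: l) = (if y = x + 1 then 1 else 0) + ascents (y :: l) := by
  simp [ascents]

theorem ascents_add_le (l₁ l₂ : List ℕ) : ascents l₁ + ascents l₂ ≤ ascents (l₁ ++ l₂) := by
  induction l₁ with
  | nil => simp [ascents]
  | cons x t ih =>
    cases t with
    | nil => simp [ascents]
    | cons y t =>
      simp only [List.cons_append, ascents_cons_cons] at ih ⊢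
      omega

/-- Only the seam can create a new ascent. -/
theorem ascents_append_le (l₁ l₂ : List ℕ) :
    ascents (l₁ ++ l₂) ≤ ascents l₁ + ascents l₂ + 1 := by
  induction l₁ with
  | nil => simp [ascents]
  | cons x t ih =>
    cases t with
    | nil =>
      simp only [ascents, List.cons_append, List.nil_append]
      split_ifs <;> omega
    | cons y t =>
      simp only [List.cons_append, ascents_cons_cons] at ih ⊢
      omega

theorem ascents_range (n : ℕ) : ascents (List.range (n + 1)) = n := by
  have (s n : ℕ) : ascents (List.range' s (n + 1)) = n := by
    induction n generalizing s with
    | zero => simp [ascents]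
    | succ n ih =>
      have := ih (s + 1)
      rw [List.range'_succ, ascents, this, List.range'_succ]
      simp [add_comm]
  rw [List.range_eq_range']
  exact this 0 n

theorem ascents_reverse_range (n : ℕ) : ascents (List.range n).reverse = 0 := by
  induction n with
  | zero => rfl
  | succ n ih =>
    rw [List.range_succ, List.reverse_append, List.reverse_singleton, List.singleton_append,
      ascents, ih, if_neg]
    intro h
    have := List.mem_of_head? h
    simp at this

theorem le_ascents_adjanLeft (n : ℕ) : 3 * n ≤ ascents (adjanLeft (n + 1)) := by
  have h1 := ascents_add_le (List.range (n + 1)) (List.range (n + 1)).reverse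
  have h2 := ascents_add_le (List.range (n + 1) ++ (List.range (n + 1)).reverse)
    (List.range (n + 1))
  have h3 := ascents_add_le (List.range (n + 1) ++ (List.range (n + 1)).reverse ++
    List.range (n + 1)) (List.range (n + 1))
  have h4 := ascents_add_le (List.range (n + 1) ++ (List.range (n + 1)).reverse ++
    List.range (n + 1) ++ List.range (n + 1)) (List.range (n + 1)).reverse
  simp only [ascents_range] at *
  rw [adjanLeft]
  omega

/-- Two ascending runs and four seams; the reversed runs contribute nothing. -/
theorem ascents_adjanRight_le (n : ℕ) : ascents (adjanRight (n + 1)) ≤ 2 * n + 4 := by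
  have h1 := ascents_append_le (List.range (n + 1)) (List.range (n + 1)).reverse
  have h2 := ascents_append_le (List.range (n + 1) ++ (List.range (n + 1)).reverse)
    (List.range (n + 1)).reverse
  have h3 := ascents_append_le (List.range (n + 1) ++ (List.range (n + 1)).reverse ++
    (List.range (n + 1)).reverse) (List.range (n + 1))
  have h4 := ascents_append_le (List.range (n + 1) ++ (List.range (n + 1)).reverse ++
    (List.range (n + 1)).reverse ++ List.range (n + 1)) (List.range (n + 1)).reverse
  simp only [ascents_range, ascents_reverse_range] at *
  rw [adjanRight]
  omega

theorem sum_ascents_le (g : ℕ → List ℕ) (p : List ℕ) :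
    (p.map fun t => ascents (g t)).sum ≤ ascents (p.flatMap g) := by
  induction p with
  | nil => simp
  | cons t p ih =>
    have := ascents_add_le (g t) (p.flatMap g)
    simp only [List.map_cons, List.sum_cons, List.flatMap_cons]
    omega

theorem ascents_flatMap_le (g : ℕ → List ℕ) (p : List ℕ) :
    ascents (p.flatMap g) ≤ (p.map fun t => ascents (g t)).sum + p.length := by
  induction p with
  | nil => simp [ascents]
  | cons t p ih =>
    have := ascents_append_le (g t) (p.flatMap g)
    simp only [List.map_cons, List.sum_cons, List.flatMap_cons, List.length_cons]
    omega

theorem count_le_count_flatMap {g : ℕ → List ℕ} {t c : ℕ} (hc : c ∈ g t) (p : List ℕ) :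
    p.count t ≤ (p.flatMap g).count c := by
  induction p with
  | nil => simp
  | cons s p ih =>
    rw [List.flatMap_cons, List.count_append, List.count_cons]
    split_ifs with hs
    · have : s = t := by simpa using hs
      have := List.count_pos_iff.2 (this ▸ hc)
      omega
    · omega

theorem length_le_of_count_le {p : List ℕ} {c k : ℕ} (hc : ∀ t, p.count t ≤ c)
    (hk : p.toFinset.card ≤ k) : p.length ≤ c * k := by
  rw [← List.sum_toFinset_count_eq_length]
  calc ∑ t ∈ p.toFinset, p.count t ≤ ∑ _t ∈ p.toFinset, c := Finset.sum_le_sum fun t _ => hc t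
    _ = c * p.toFinset.card := by rw [Finset.sum_const, smul_eq_mul, mul_comm]
    _ ≤ c * k := Nat.mul_le_mul_left _ hk

/-- A substitution instance of a balanced identity in few variables cannot carry
`P Q P P Q` to `P Q Q P Q`. -/
theorem append_flatMap_ne_adjanRight {k : ℕ} {p q a b : List ℕ} {g : ℕ → List ℕ}
    (hg : ∀ t, g t ≠ []) (hpq : p.Perm q) (hk : p.toFinset.card ≤ k)
    (hp : a ++ p.flatMap g ++ b = adjanLeft (5 * k + 8)) :
    a ++ q.flatMap g ++ b ≠ adjanRight (5 * k + 8) := by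
  intro hq
  have hcount (t : ℕ) : p.count t ≤ 5 := by
    obtain ⟨c, hc⟩ := List.exists_mem_of_ne_nil _ (hg t)
    have h1 := count_le_count_flatMap hc p
    have h2 := count_adjanLeft (5 * k + 8) c
    rw [← hp, List.count_append, List.count_append] at h2
    split_ifs at h2 <;> omega
  have hlen := length_le_of_count_le hcount hk
  -- Both sides use the same blocks with the same multiplicities, so ascents inside blocks cancel.
  have hsum : (p.map fun t => ascents (g t)).sum = (q.map fun t => ascents (g t)).sum :=
    (hpq.map _).sum_eq
  have h1 := ascents_append_le (a ++ p.flatMap g) b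
  have h2 := ascents_append_le a (p.flatMap g)
  have h3 := ascents_flatMap_le g p
  have h4 := ascents_add_le (a ++ q.flatMap g) b
  have h5 := ascents_add_le a (q.flatMap g)
  have h6 := sum_ascents_le g q
  have h7 : _ ≤ ascents (adjanLeft (5 * k + 8)) := le_ascents_adjanLeft (5 * k + 7)
  have h8 : ascents (adjanRight (5 * k + 8)) ≤ _ := ascents_adjanRight_le (5 * k + 7)
  rw [hp] at h1
  rw [hq] at h4
  -- Seams account for at most `5k + 2` ascents, but the gap is at least `(5k + 7) - 4 = 5k + 3`.
  omega

/-! ### Derivations -/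

/-- The list of letters of a word. -/
def letters (w : Word) : List ℕ := w.head :: w.tail

theorem letters_mul (x y : Word) : letters (x * y) = letters x ++ letters y := rfl

theorem letters_ne_nil (w : Word) : letters w ≠ [] := List.cons_ne_nil _ _

theorem exists_letters_eq {l : List ℕ} (hl : l ≠ []) : ∃ w : Word, letters w = l := by
  cases l with
  | nil => exact absurd rfl hl
  | cons h t => exact ⟨⟨h, t⟩, rfl⟩

theorem toFinset_letters (w : Word) : (letters w).toFinset = content w := by
  simp [letters, content]

theorem letters_hom (θ : Word →ₙ* Word) (w : Word) :
    letters (θ w) = (letters w).flatMap fun t => letters (θ (FreeSemigroup.of t)) := by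
  induction w using FreeSemigroup.recOnMul with
  | ih1 x => simp [letters, FreeSemigroup.of]
  | ih2 x y hx hy => rw [map_mul, letters_mul, letters_mul, List.flatMap_append, hy, ← hx]

theorem hom_eq_prod {M : Type*} [Monoid M] (φ : Word →ₙ* M) (w : Word) :
    φ w = ((letters w).map fun t => φ (FreeSemigroup.of t)).prod := by
  induction w using FreeSemigroup.recOnMul with
  | ih1 x => simp [letters, FreeSemigroup.of]
  | ih2 x y hx hy => rw [map_mul, letters_mul, List.map_append, List.prod_append, hy, ← hx]

theorem mem_identities_iff {M : Type*} [Monoid M] {e : Word × Word} :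
    e ∈ identities M ↔
      ∀ f : ℕ → M, ((letters e.1).map f).prod = ((letters e.2).map f).prod := by
  constructor
  · intro h f
    have := h (FreeSemigroup.lift f)
    simpa [hom_eq_prod] using this
  · intro h φ
    rw [hom_eq_prod, hom_eq_prod]
    exact h _

/-- The syntactic congruence of the one element language `{u}`. -/
def syntacticCon (u : List ℕ) : Con Word where
  r x y := ∀ a b : List ℕ, a ++ letters x ++ b = u ↔ a ++ letters y ++ b = u
  iseqv := ⟨fun _ _ _ => Iff.rfl, fun h a b => (h a b).symm, fun h h' a b => (h a b).trans (h' a b)⟩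
  mul' := by
    intro w x y z hwx hyz a b
    have h1 := hwx a (letters y ++ b)
    have h2 := hyz (a ++ letters x) b
    simp only [letters_mul, ← List.append_assoc] at h1 h2 ⊢
    exact h1.trans h2

theorem prod_map_flatMap {M : Type*} [Monoid M] (f : ℕ → M) (g : ℕ → List ℕ) (p : List ℕ) :
    ((p.flatMap g).map f).prod = (p.map fun t => ((g t).map f).prod).prod := by
  induction p with
  | nil => simp
  | cons t p ih => simp [ih]

/-- If a monoid satisfies `P Q P P Q ≈ P Q Q P Q` for all lengths of `P`, and its identities
preserve the maxima of linear functionals on prefix vectors, then its axiomatic rank is infinite. -/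
theorem axiomaticRank_eq_top {M : Type*} [Monoid M]
    (hM : ∀ n (f : ℕ → M), ((adjanLeft n).map f).prod = ((adjanRight n).map f).prod)
    (hmax : ∀ l l' : List ℕ, (∀ f : ℕ → M, (l.map f).prod = (l'.map f).prod) → SameMaxima l l') :
    axiomaticRank M = ⊤ := by
  simp only [axiomaticRank, iInf_eq_top]
  rintro k ⟨Γ, ⟨hΓ, hcons⟩, hk⟩
  exfalso
  set n := 5 * k + 8 with hn
  have hu : adjanLeft n ≠ [] := by simp [adjanLeft, hn]
  have hv : adjanRight n ≠ [] := by simp [adjanRight, hn]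
  obtain ⟨u, hu⟩ := exists_letters_eq hu
  obtain ⟨v, hv⟩ := exists_letters_eq hv
  have huv : ((u, v) : Word × Word) ∈ consequences Γ := by
    rw [hcons, mem_identities_iff]
    intro f
    simp only [hu, hv, hM]
  have step {p q : Word} (hpq : (p, q) ∈ identities M) (hp : (content p).card ≤ k)
      (θ : Word →ₙ* Word) (a b : List ℕ) (h : a ++ letters (θ p) ++ b = adjanLeft n) :
      a ++ letters (θ q) ++ b = adjanLeft n := by
    rw [mem_identities_iff] at hpq
    have hperm : (letters p).Perm (letters q) :=
      List.perm_iff_count.2 (hmax _ _ hpq).count_eq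
    rw [letters_hom] at h ⊢
    have hne := append_flatMap_ne_adjanRight (fun t => letters_ne_nil _) hperm
      (by rwa [toFinset_letters]) h
    -- The rewritten word has the same value as `adjanLeft n` under every `f`, so rigidity applies.
    refine (SameMaxima.eq_adjanLeft_or_eq_adjanRight (hmax _ _ fun f => ?_)).resolve_right hne
    rw [← h]
    simp only [List.map_append, List.prod_append, prod_map_flatMap]
    rw [hpq]
  -- By `step`, no instance of `Γ` moves `adjanLeft n`, in either direction and in any context.
  have hle : conGen (fun a b : Word => ∃ p ∈ Γ, ∃ θ : Word →ₙ* Word, a = θ p.1 ∧ b = θ p.2) ≤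
      syntacticCon (adjanLeft n) := by
    refine Con.conGen_le.2 ?_
    rintro _ _ ⟨p, hp, θ, rfl, rfl⟩ a b
    have h1 := hΓ hp
    have h2 := hk p hp
    refine ⟨step h1 ((Finset.card_le_card Finset.subset_union_left).trans h2) θ a b,
      step (fun φ => (h1 φ).symm) ((Finset.card_le_card Finset.subset_union_right).trans h2) θ a b⟩
  have h := (hle huv [] []).1 (by simp [hu])
  rw [List.nil_append, List.append_nil, hv] at h
  have h7 : _ ≤ ascents (adjanLeft (5 * k + 8)) := le_ascents_adjanLeft (5 * k + 7)
  have h8 : ascents (adjanRight (5 * k + 8)) ≤ _ := ascents_adjanRight_le (5 * k + 7)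
  rw [hn] at h
  rw [h] at h8
  omega

open Tropical OrderDual

/-! ### Upper triangular tropical matrices -/

/-- The element `r` of the max-plus semiring. -/
def maxPlusOf {R : Type*} (r : R) : MaxPlus R := trop ((toDual r : Rᵒᵈ) : WithTop Rᵒᵈ)

theorem maxPlusOf_add {R : Type*} [Add R] (r s : R) :
    maxPlusOf (r + s) = maxPlusOf r * maxPlusOf s := rfl

theorem maxPlusOf_zero {R : Type*} [Zero R] : maxPlusOf (0 : R) = 1 := rfl

theorem maxPlusOf_le {R : Type*} [LinearOrder R] {r s : R} :
    maxPlusOf r ≤ maxPlusOf s ↔ s ≤ r := by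
  simp [maxPlusOf, ← untrop_le_iff]

/-- The order is reversed: `m ≤ x` says that `m` bounds `x` from above in `R ∪ {-∞}`, and the empty
sum `-∞` is the top element. -/
theorem le_listSum_iff {R : Type*} [LinearOrder R] {m : MaxPlus R} {l : List (MaxPlus R)} :
    m ≤ l.sum ↔ ∀ x ∈ l, m ≤ x := by
  induction l with
  | nil => simp
  | cons x l ih =>
    have : x + l.sum = min x l.sum := (congrFun₂ min_eq_add x _).symm
    rw [List.sum_cons, this, le_min_iff, ih]
    simp

section

variable {R : Type*} [AddCommGroup R] [LinearOrder R] [IsOrderedAddMonoid R]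

/-- In the max-plus semiring, `a² c ≤ c³ ⊕ a³`. -/
theorem sq_mul_add_cubes (a c : MaxPlus R) :
    a * a * c + (c * c * c + a * a * a) = c * c * c + a * a * a := by
  rcases le_total a c with h | h
  · have h1 : a * a * a ≤ a * a * c := mul_le_mul_right h _
    rw [add_left_comm, add_eq_right h1]
  · have h1 : c * c * c ≤ a * a * c := mul_le_mul_left (mul_le_mul' h h) _
    rw [← add_assoc, add_eq_right h1]

/-- Upper triangular matrices with equal diagonals satisfy `ABAAB = ABBAB`. -/
theorem adjan_identity_matrix {A B : Matrix (Fin 2) (Fin 2) (MaxPlus R)}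
    (hA : A 1 0 = 0) (hB : B 1 0 = 0) (h0 : A 0 0 = B 0 0) (h1 : A 1 1 = B 1 1) :
    A * B * A * A * B = A * B * B * A * B := by
  ext i j
  fin_cases i <;> fin_cases j
  · simp [Matrix.mul_apply, Fin.sum_univ_two, hA, hB, h0]
  · simp only [Matrix.mul_apply, Fin.sum_univ_two, hA, hB, ← h0, ← h1, Fin.zero_eta, Fin.mk_one,
      mul_zero, add_zero]
    generalize A 0 0 = a
    generalize A 1 1 = c
    generalize A 0 1 = b
    generalize B 0 1 = d
    have e1 := sq_mul_add_cubes a c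
    have e2 := sq_mul_add_cubes c a
    -- The two entries differ only in the middle term, `bc · a²c` against `ad · c²a`; each is
    -- absorbed into this common value.
    trans b * c * (c * c * c + a * a * a) + a * d * (a * a * a + c * c * c)
    · rw [← e1]
      ring
    · rw [← e2]
      ring
  · simp [Matrix.mul_apply, Fin.sum_univ_two, hA, hB]
  · simp [Matrix.mul_apply, Fin.sum_univ_two, hA, hB, h1]

theorem lower_eq_zero (A : UpperTriangularMonoid 2 (MaxPlus R)) : A.1 1 0 = 0 :=
  A.2 (by simp : (0 : Fin 2) < 1)

theorem prod_apply_diag (f : ℕ → UpperTriangularMonoid 2 (MaxPlus R)) (l : List ℕ) (k : Fin 2) :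
    (l.map f).prod.1 k k = (l.map fun t => (f t).1 k k).prod := by
  induction l with
  | nil => simp
  | cons h t ih =>
    rw [List.map_cons, List.prod_cons, List.map_cons, List.prod_cons, ← ih]
    have h1 := lower_eq_zero (f h)
    have h2 := lower_eq_zero (t.map f).prod
    rw [Submonoid.coe_mul, Matrix.mul_apply, Fin.sum_univ_two]
    fin_cases k
    · simp only [Fin.zero_eta, h2, mul_zero, add_zero]
    · simp only [Fin.mk_one, h1, zero_mul, zero_add]

theorem prod_adjanLeft_eq (n : ℕ) (f : ℕ → UpperTriangularMonoid 2 (MaxPlus R)) :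
    ((adjanLeft n).map f).prod = ((adjanRight n).map f).prod := by
  have hdiag (k : Fin 2) : ((List.range n).map f).prod.1 k k =
      ((List.range n).reverse.map f).prod.1 k k := by
    rw [prod_apply_diag, prod_apply_diag]
    exact (((List.range n).reverse_perm.symm).map _).prod_eq
  apply Subtype.ext
  simp only [adjanLeft, adjanRight, List.map_append, List.prod_append, Submonoid.coe_mul]
  exact adjan_identity_matrix (lower_eq_zero _) (lower_eq_zero _) (hdiag 0) (hdiag 1)

end

section

variable {R : Type*} [CommRing R] [LinearOrder R] [IsStrictOrderedRing R]

/-- The substitution whose value at a word records the maximum of `L` on the prefix vectors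
of the letter `i`. -/
def testSubstitution (i : ℕ) (L : (ℕ → ℤ) →+ ℤ) (h : ℕ) : UpperTriangularMonoid 2 (MaxPlus R) :=
  ⟨!![maxPlusOf ((L (Pi.single h 1) : ℤ) : R), if h = i then 1 else 0; 0, 1], by
    intro r s hrs
    fin_cases r <;> fin_cases s <;> simp at hrs ⊢⟩

/-- A path from row 0 to column 1 crosses over at one occurrence of `i`: the letters before it
contribute `L` of the prefix vector, those after it contribute 1. -/
theorem prod_testSubstitution (i : ℕ) (L : (ℕ → ℤ) →+ ℤ) (l : List ℕ) :
    (l.map (testSubstitution (R := R) i L)).prod.1 0 1 =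
        ((prefixVectors i l).map fun v => maxPlusOf ((L v : ℤ) : R)).sum ∧
      (l.map (testSubstitution (R := R) i L)).prod.1 1 1 = 1 := by
  induction l with
  | nil => simp [prefixVectors]
  | cons h t ih =>
    obtain ⟨ih1, ih2⟩ := ih
    rw [List.map_cons, List.prod_cons, Submonoid.coe_mul]
    refine ⟨?_, ?_⟩
    · rw [Matrix.mul_apply, Fin.sum_univ_two, ih1, ih2]
      have hmap : ((prefixVectors i t).map
          (Pi.single h 1 + ·)).map (fun v => maxPlusOf ((L v : ℤ) : R)) =
          (prefixVectors i t).map fun v =>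
            maxPlusOf ((L (Pi.single h 1) : ℤ) : R) * maxPlusOf ((L v : ℤ) : R) := by
        simp [Function.comp_def, maxPlusOf_add]
      rw [prefixVectors, List.map_append, List.sum_append, hmap, List.sum_map_mul_left]
      simp only [testSubstitution]
      split_ifs <;> simp [maxPlusOf_zero, add_comm]
    · rw [Matrix.mul_apply, Fin.sum_univ_two, ih2]
      simp [testSubstitution]

theorem sameMaxima_of_prod_eq {l l' : List ℕ}
    (h : ∀ f : ℕ → UpperTriangularMonoid 2 (MaxPlus R), (l.map f).prod = (l'.map f).prod) :
    SameMaxima l l' := by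
  intro i L m
  have key (w : List ℕ) : (∀ v ∈ prefixVectors i w, L v ≤ m) ↔
      maxPlusOf (m : R) ≤ (w.map (testSubstitution (R := R) i L)).prod.1 0 1 := by
    rw [(prod_testSubstitution i L w).1, le_listSum_iff]
    simp [maxPlusOf_le]
  rw [key, key, h]

/-- The monoid of upper triangular tropical matrices of size two has infinite axiomatic rank. -/
theorem axiomaticRank_upperTriangular :
    axiomaticRank (UpperTriangularMonoid 2 (MaxPlus R)) = ⊤ :=
  axiomaticRank_eq_top prod_adjanLeft_eq fun _ _ => sameMaxima_of_prod_eq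

end

end SemigroupIdentity

theorem corollary5p6 :
    SemigroupIdentity.axiomaticRank (UpperTriangularMonoid 2 (MaxPlus ℝ)) = ⊤ ∧
      SemigroupIdentity.axiomaticRank (UpperTriangularMonoid 2 (MaxPlus ℤ)) = ⊤ :=
  ⟨SemigroupIdentity.axiomaticRank_upperTriangular, SemigroupIdentity.axiomaticRank_upperTriangular⟩
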